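/- Let $d\ge 0$ and let $q_1,\dots,q_d\ge 1$ be polynomial degrees. For $q\ge1$ let $\mathcal G_q\subset[-1,1]$ be the set of the $q+1$ Gauss–Lobatto nodes ($\pm1$ and the zeros of $P_q'$, with $P_q$ the Legendre polynomial), with Lagrange polynomials $\ell_a$ and weights $\int_{-1}^1\ell_a$ ($a\in\mathcal G_q$). On the reference element $\hat\Omega=[-1,1]^d$ let $\hat x_k$, $\hat w_k$, $\hat\varphi_k$, $k\in\mathcal G_{q_1}\times\dots\times\mathcal G_{q_d}$, be the tensor-product nodes, weights and Lagrange basis functions. Consider a finite mesh of elements $\Omega_e=F_e(\hat\Omega)\subset\mathbb R^d$, where the $F_e$ are bijective affine maps with Jacobian $J_e$ and the elements have pairwise disjoint interiors, and set $\Omega=\bigcup_e\Omega_e$. The mesh is $C^0$-conforming: for every point $z$, the shape functions attached to $z$ on the elements ($\hat\varphi_k\circ F_e^{-1}$ if $z=F_e(\hat x_k)$, and $0$ if $z$ is not a node of $\Omega_e$) coincide wherever two elements meet, and so define a global nodal basis function $\varphi_z$. Let $\Gamma\subset\mathbb R^d$ be any set of Dirichlet points (e.g. $\Gamma=\emptyset$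 or $\Gamma=\partial\Omega$), and let $x_1,\dots,x_n$ be the distinct points among the nodes $F_e(\hat x_k)$ that do not lie in $\Gamma$, with basis functions $\varphi_1,\dots,\varphi_n$. Let $\kappa>0$ be integrable on $\Omega$, and let the density $\rho$ be equal to a constant $\rho_e>0$ in the interior of each element $\Omega_e$. Define the stiffness matrix, the consistent mass matrix and the nodal-quadrature lumped mass matrix by $$K_{ij}=\int_\Omega\kappa\,\nabla\varphi_i\cdot\nabla\varphi_j\,dx,\qquad M_{ij}=\int_\Omega\rho\,\varphi_i\varphi_j\,dx,\qquad \widehat M_{ij}=\sum_e\sum_k \hat w_k\,\rho_e\,|\det J_e|\,\varphi_i(F_e(\hat x_k))\,\varphi_j(F_e(\hat x_k)).$$ Then $M$ and $\widehat M$ are positive definite and $\widehat M\succeq M$, i.e. $\widehat M-M$ is positive semidefinite. The pairs $(K,M)$ and $(K,\widehat M)$ each have exactly $n$ real generalized eigenvalues, counted with multiplicity as zeros of $\lambda\mapsto\det(K-\lambda M)$ and $\lambda\mapsto\det(K-\lambda\widehat M)$. In nondecreasing order these satisfy $$\lambda_k(K,\widehat M)\le\lambda_k(K,M),\qquad k=1,\dots,n.$$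 Consequently the critical time step of the explicit central difference scheme does not shrink: $2/\sqrt{\lambda_n(K,M)}\le 2/\sqrt{\lambda_n(K,\widehat M)}$ (read as $+\infty$ where the eigenvalue is $0$, and trivial if $n=0$). -/

import Mathlib

noncomputable section

namespace SpectralFEM

open Polynomial

/-! ## One-dimensional Gauss-Lobatto rule and Lagrange basis on the interval from -1 to 1 -/

/-- The Legendre polynomial `P_q` (Rodrigues' formula). -/
def legendre (q : ℕ) : ℝ[X] :=
  C (1 / (2 ^ q * (q.factorial : ℝ))) * derivative^[q] ((X ^ 2 - 1) ^ q)

open Classical in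
/-- The Gauss-Lobatto nodes of degree `q ≥ 1`: the points `-1`, `1` and the zeros of `P_q'`. -/
def glNodes (q : ℕ) : Finset ℝ :=
  ((X ^ 2 - 1) * derivative (legendre q)).roots.toFinset

open Classical in
/-- The Lagrange polynomial of degree `q` attached to the Gauss-Lobatto node `a`:
the product of `(X - b) / (a - b)` over all the other Gauss-Lobatto nodes `b`. -/
def glLagrange (q : ℕ) (a : glNodes q) : ℝ[X] :=
  Lagrange.basis (glNodes q) id (a : ℝ)

/-- The Gauss-Lobatto weight of the node `a` (the rule is interpolatory). -/
def glWeight (q : ℕ) (a : glNodes q) : ℝ :=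
  ∫ t in (-1 : ℝ)..1, (glLagrange q a).eval t

/-! ## The tensor-product reference element -/

/-- The reference element `[-1, 1]^d`. -/
def refCube (d : ℕ) : Set (EuclideanSpace ℝ (Fin d)) :=
  {x | ∀ j, x j ∈ Set.Icc (-1 : ℝ) 1}

/-- Local multi-indices: one Gauss-Lobatto node in each of the `d` directions
(the degree in direction `j` is `q j`). -/
abbrev LocalIndex {d : ℕ} (q : Fin d → ℕ) : Type :=
  (j : Fin d) → glNodes (q j)

variable {d : ℕ} {q : Fin d → ℕ}

/-- Reference quadrature node with multi-index `k`. -/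
def refNode (k : LocalIndex q) : EuclideanSpace ℝ (Fin d) :=
  WithLp.toLp 2 fun j => (k j : ℝ)

/-- Reference quadrature weight with multi-index `k`. -/
def refWeight (k : LocalIndex q) : ℝ :=
  ∏ j, glWeight (q j) (k j)

/-- Reference (tensor-product Lagrange) shape function with multi-index `k`. -/
def refBasis (k : LocalIndex q) (x : EuclideanSpace ℝ (Fin d)) : ℝ :=
  ∏ j, (glLagrange (q j) (k j)).eval (x j)

open Classical in
/-- The shape function, on the element with affine map `F`, that is attached to the point `z`:
it is `refBasis k ∘ F⁻¹` if `z = F (refNode k)` is a node of the element, and `0` if `z` is not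
a node of the element. -/
def elementBasis (q : Fin d → ℕ)
    (F : EuclideanSpace ℝ (Fin d) ≃ᵃ[ℝ] EuclideanSpace ℝ (Fin d))
    (z x : EuclideanSpace ℝ (Fin d)) : ℝ :=
  ∑ k : LocalIndex q, if F (refNode k) = z then refBasis k (F.symm x) else 0

/-! ## Meshes, global nodal basis, bilinear forms -/

/-- A mesh of affine tensor-product spectral elements with `q j` the degree in direction `j`.
Each element is the image of the reference element under a bijective affine map. -/
structure Mesh (d : ℕ) (q : Fin d → ℕ) (E : Type*) where
  /-- the affine map from the reference element to the element `e` -/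
  map : E → (EuclideanSpace ℝ (Fin d) ≃ᵃ[ℝ] EuclideanSpace ℝ (Fin d))
  /-- the elements do not overlap -/
  disjoint_interior : Pairwise fun e e' =>
    Disjoint (interior (map e '' refCube d)) (interior (map e' '' refCube d))
  /-- the mesh is `C⁰`-conforming: where two elements meet, the shape functions that they attach
  to the same point agree, so that they can be glued together to global functions -/
  conforming : ∀ e e' x, x ∈ map e '' refCube d → x ∈ map e' '' refCube d →
    ∀ z, elementBasis q (map e) z x = elementBasis q (map e') z x

namespace Mesh

variable {E : Type*} (T : Mesh d q E)

/-- The (closed) physical element `e`. -/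
def element (e : E) : Set (EuclideanSpace ℝ (Fin d)) := T.map e '' refCube d

/-- The (closed) physical domain, the union of the elements. -/
def domain : Set (EuclideanSpace ℝ (Fin d)) := ⋃ e, T.element e

/-- `|det J_e|`, with `J_e` the Jacobian of the affine map of the element `e`. -/
def absJac (e : E) : ℝ :=
  |LinearMap.det ((T.map e).linear :
    EuclideanSpace ℝ (Fin d) →ₗ[ℝ] EuclideanSpace ℝ (Fin d))|

open Classical in
/-- The global nodal basis function attached to the node `z`, glued together from the element
shape functions (and set to `0` outside the domain). -/
def basis (z x : EuclideanSpace ℝ (Fin d)) : ℝ :=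
  if h : ∃ e, x ∈ T.element e then elementBasis q (T.map h.choose) z x else 0

/-- The gluing does not depend on choices: on every element `e`, the global basis function is the
shape function of `e`. -/
theorem basis_eq_elementBasis (z : EuclideanSpace ℝ (Fin d)) {x : EuclideanSpace ℝ (Fin d)}
    {e : E} (hx : x ∈ T.element e) : T.basis z x = elementBasis q (T.map e) z x := by
  have h : ∃ e, x ∈ T.element e := ⟨e, hx⟩
  unfold basis
  rw [dif_pos h]
  exact T.conforming _ _ x h.choose_spec hx z

open Classical in
/-- The nodes that carry the degrees of freedom: the images of all the reference nodes in all the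
elements (a node shared by several elements counts once), without those that lie in the set `Γ`
where homogeneous Dirichlet conditions are imposed. -/
def freeNodes [Fintype E] (Γ : Set (EuclideanSpace ℝ (Fin d))) :
    Finset (EuclideanSpace ℝ (Fin d)) :=
  (Finset.univ.image fun p : E × LocalIndex q => T.map p.1 (refNode p.2)).filter (· ∉ Γ)

/-- Stiffness form `a(u, v) = ∫_Ω κ ∇u · ∇v`. -/
def stiffForm (κ u v : EuclideanSpace ℝ (Fin d) → ℝ) : ℝ :=
  ∫ x in T.domain, κ x * inner ℝ (gradient u x) (gradient v x)

/-- Consistent mass form `b(u, v) = ∫_Ω ρ u v`. -/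
def massForm (ρ u v : EuclideanSpace ℝ (Fin d) → ℝ) : ℝ :=
  ∫ x in T.domain, ρ x * u x * v x

/-- Lumped mass form: the elementwise Gauss-Lobatto nodal quadrature of the mass form, for a
density that takes the constant value `ρe e` on the element `e`. -/
def lumpedForm [Fintype E] (ρe : E → ℝ) (u v : EuclideanSpace ℝ (Fin d) → ℝ) : ℝ :=
  ∑ e, ∑ k : LocalIndex q, refWeight k * ρe e * T.absJac e *
    u (T.map e (refNode k)) * v (T.map e (refNode k))

variable [Fintype E] (Γ : Set (EuclideanSpace ℝ (Fin d)))

/-- Stiffness matrix `K`. -/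
def stiffMatrix (κ : EuclideanSpace ℝ (Fin d) → ℝ) :
    Matrix (T.freeNodes Γ) (T.freeNodes Γ) ℝ :=
  Matrix.of fun i j => T.stiffForm κ (T.basis i) (T.basis j)

/-- Consistent mass matrix `M`. -/
def massMatrix (ρ : EuclideanSpace ℝ (Fin d) → ℝ) :
    Matrix (T.freeNodes Γ) (T.freeNodes Γ) ℝ :=
  Matrix.of fun i j => T.massForm ρ (T.basis i) (T.basis j)

/-- Nodal-quadrature lumped mass matrix. -/
def lumpedMatrix (ρe : E → ℝ) : Matrix (T.freeNodes Γ) (T.freeNodes Γ) ℝ :=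
  Matrix.of fun i j => T.lumpedForm ρe (T.basis i) (T.basis j)

end Mesh

/-! ## Generalized eigenvalues -/

section GenEig

variable {n : Type*} [Fintype n]

open Classical in
/-- The real generalized eigenvalues of the pair `(A, B)`, that is, the real zeros of
`det (A - t B)` with multiplicity, as a nondecreasing list. -/
def genEigList (A B : Matrix n n ℝ) : List ℝ :=
  ((A.map C - (X : ℝ[X]) • B.map C).det.roots).sort (· ≤ ·)

/-- The `k`-th smallest generalized eigenvalue, with `k` counted from `0`. -/
def genEig (A B : Matrix n n ℝ) (k : ℕ) : ℝ := (genEigList A B).getD k 0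

/-- The critical time step `2 / √λ_max` of the explicit central difference scheme for
`B u'' + A u = f` (infinite if `λ_max` is zero). -/
def criticalTimeStep (A B : Matrix n n ℝ) : ENNReal :=
  2 / ENNReal.ofReal (Real.sqrt (genEig A B (Fintype.card n - 1)))

end GenEig

end SpectralFEM

end

/-! The mass matrix is a Gram matrix and the lumped mass matrix is the quadrature of the same Gram
matrix, so in one dimension the claim is that the Gauss-Lobatto rule overestimates `∫ p²` for every
polynomial `p` of degree at most `q`. Divide `p²` by the nodal polynomial `w = (X² - 1) P_q'`, of
degree `q + 1`. The rule is exact on the remainder, so its error is `-∫ w g`, where `g` is the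
quotient, of degree at most `q - 1` and with nonnegative top coefficient. Integration by parts gives
`∫ w g = -∫ P_q ((X² - 1) g)'`, and the orthogonality of `P_q` to lower degrees reduces this to a
nonpositive multiple of the top coefficient of `g`.

On the reference element both matrices are entrywise products of their one-dimensional factors, and
the Schur product theorem lifts the inequality. Congruence with the local-to-global incidence
matrices, followed by summation over the elements, lifts it to the mesh. Finally, enlarging the
right-hand matrix of a pencil whose left-hand matrix is positive semidefinite lowers all the
Rayleigh quotients, hence, by Courant-Fischer, all the eigenvalues. -/

noncomputable section

namespace SpectralFEM

/-! ## The Gauss-Lobatto rule overestimates squares -/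

section GaussLobatto

open Polynomial Finset Function

theorem exists_finset_deriv_eq_zero {f f' : ℝ → ℝ} {a b : ℝ} (hf : ∀ x, HasDerivAt f (f' x) x)
    (s : Finset ℝ) (hs : ∀ x ∈ s, x ∈ Set.Icc a b ∧ f x = 0) :
    ∃ t : Finset ℝ, #s ≤ #t + 1 ∧ ∀ x ∈ t, x ∈ Set.Ioo a b ∧ f' x = 0 := by
  obtain h | ⟨n, hn⟩ : #s = 0 ∨ ∃ n, #s = n + 1 := by
    cases #s <;> simp
  · exact ⟨∅, by simp [h]⟩
  let e := s.orderEmbOfFin hn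
  have hmem (i) : e i ∈ Set.Icc a b ∧ f (e i) = 0 := hs _ (s.orderEmbOfFin_mem hn i)
  have rolle (i : Fin n) : ∃ x ∈ Set.Ioo (e i.castSucc) (e i.succ), f' x = 0 :=
    exists_hasDerivAt_eq_zero (e.strictMono i.castSucc_lt_succ)
      (fun x _ => (hf x).continuousAt.continuousWithinAt)
      ((hmem _).2.trans (hmem _).2.symm) fun x _ => hf x
  choose c hc hc0 using rolle
  have hmono : StrictMono c := fun i j hij =>
    (hc i).2.trans_le ((e.monotone hij).trans (hc j).1.le)
  refine ⟨univ.map ⟨c, hmono.injective⟩, by simp [hn], fun x hx => ?_⟩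
  obtain ⟨i, -, rfl⟩ := Finset.mem_map.1 hx
  exact ⟨⟨(hmem _).1.1.trans_lt (hc i).1, (hc i).2.trans_le (hmem _).1.2⟩, hc0 i⟩

theorem exists_finset_iterate_derivative_eval_eq_zero {p : ℝ[X]} {a b : ℝ} (hab : a < b) {n : ℕ}
    (ha : ∀ k < n, (derivative^[k] p).eval a = 0) (hb : ∀ k < n, (derivative^[k] p).eval b = 0) :
    ∃ s : Finset ℝ, n ≤ #s ∧ ∀ x ∈ s, x ∈ Set.Ioo a b ∧ (derivative^[n] p).eval x = 0 := by
  induction n with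
  | zero => exact ⟨∅, by simp⟩
  | succ n ih =>
    obtain ⟨s, hns, hs⟩ := ih (fun k hk => ha k (by lia)) (fun k hk => hb k (by lia))
    have has : a ∉ insert b s := by
      simpa [hab.ne] using fun h => lt_irrefl a (hs a h).1.1
    have hbs : b ∉ s := fun h => lt_irrefl b (hs b h).1.2
    obtain ⟨t, hst, ht⟩ := exists_finset_deriv_eq_zero (derivative^[n] p).hasDerivAt
      (insert a (insert b s)) (a := a) (b := b) fun x hx => by
        rcases mem_insert.1 hx with rfl | hx
        · exact ⟨Set.left_mem_Icc.2 hab.le, ha n n.lt_succ_self⟩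
        rcases mem_insert.1 hx with rfl | hx
        · exact ⟨Set.right_mem_Icc.2 hab.le, hb n n.lt_succ_self⟩
        · exact ⟨Set.Ioo_subset_Icc_self (hs x hx).1, (hs x hx).2⟩
    rw [card_insert_of_notMem has, card_insert_of_notMem hbs] at hst
    exact ⟨t, by lia, by simpa only [iterate_succ_apply'] using ht⟩

theorem integral_derivative_mul {p : ℝ[X]} {a b : ℝ} (ha : p.eval a = 0) (hb : p.eval b = 0)
    (g : ℝ[X]) :
    ∫ t in a..b, (derivative p).eval t * g.eval t =
      -∫ t in a..b, p.eval t * (derivative g).eval t := by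
  have parts := intervalIntegral.integral_mul_deriv_eq_deriv_mul (a := a) (b := b)
    (fun t _ => p.hasDerivAt t) (fun t _ => g.hasDerivAt t)
    (p.derivative.continuous.intervalIntegrable _ _)
    (g.derivative.continuous.intervalIntegrable _ _)
  rw [ha, hb, zero_mul, zero_mul] at parts
  linarith

theorem integral_iterate_derivative_mul {p : ℝ[X]} {a b : ℝ} {n : ℕ}
    (ha : ∀ k < n, (derivative^[k] p).eval a = 0) (hb : ∀ k < n, (derivative^[k] p).eval b = 0)
    (g : ℝ[X]) :
    ∫ t in a..b, (derivative^[n] p).eval t * g.eval t =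
      (-1) ^ n * ∫ t in a..b, p.eval t * (derivative^[n] g).eval t := by
  induction n generalizing g with
  | zero => simp
  | succ n ih =>
    rw [iterate_succ_apply', integral_derivative_mul (ha n n.lt_succ_self) (hb n n.lt_succ_self),
      ih (fun k hk => ha k (by lia)) (fun k hk => hb k (by lia)), ← iterate_succ_apply, pow_succ]
    ring

theorem legendre_eq_iterate_derivative (q : ℕ) :
    legendre q = derivative^[q] (C (1 / (2 ^ q * (q.factorial : ℝ))) * (X ^ 2 - 1) ^ q) := by
  rw [legendre, iterate_derivative_C_mul]

theorem eval_iterate_derivative_C_mul_pow {p : ℝ[X]} {x : ℝ} (hx : p.eval x = 0) (c : ℝ)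
    {k n : ℕ} (h : k < n) : (derivative^[k] (C c * p ^ n)).eval x = 0 := by
  rw [iterate_derivative_C_mul, eval_C_mul,
    eval_eq_zero_of_dvd_of_eval_eq_zero (pow_sub_dvd_iterate_derivative_pow p n k)
      (by rw [eval_pow, hx, zero_pow (by lia)]), mul_zero]

theorem natDegree_X_sq_sub_one_pow (q : ℕ) : ((X ^ 2 - 1 : ℝ[X]) ^ q).natDegree = q * 2 := by
  rw [natDegree_pow, ← C_1, natDegree_X_pow_sub_C]

theorem natDegree_legendre_le (q : ℕ) : (legendre q).natDegree ≤ q :=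
  calc (legendre q).natDegree
      ≤ (derivative^[q] ((X ^ 2 - 1 : ℝ[X]) ^ q)).natDegree := natDegree_C_mul_le _ _
    _ ≤ ((X ^ 2 - 1 : ℝ[X]) ^ q).natDegree - q := natDegree_iterate_derivative _ _
    _ = q := by rw [natDegree_X_sq_sub_one_pow]; lia

theorem coeff_legendre_pos (q : ℕ) : 0 < (legendre q).coeff q := by
  have monic : ((X ^ 2 - 1 : ℝ[X]) ^ q).Monic := by
    rw [← C_1]
    exact (monic_X_pow_sub_C _ two_ne_zero).pow q
  have coeff_top : ((X ^ 2 - 1 : ℝ[X]) ^ q).coeff (q + q) = 1 := by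
    rw [← mul_two, ← natDegree_X_sq_sub_one_pow, monic.coeff_natDegree]
  rw [legendre, coeff_C_mul, coeff_iterate_derivative, coeff_top, nsmul_one]
  have := Nat.descFactorial_pos.2 (Nat.le_add_left q q)
  positivity

theorem exists_finset_legendre_eval_eq_zero (q : ℕ) :
    ∃ s : Finset ℝ, q ≤ #s ∧ ∀ x ∈ s, x ∈ Set.Ioo (-1) 1 ∧ (legendre q).eval x = 0 := by
  rw [legendre_eq_iterate_derivative]
  exact exists_finset_iterate_derivative_eval_eq_zero (by norm_num)
    (fun k => eval_iterate_derivative_C_mul_pow (by simp) _)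
    (fun k => eval_iterate_derivative_C_mul_pow (by simp) _)

theorem integral_legendre_mul {q : ℕ} {g : ℝ[X]} (hg : g.natDegree ≤ q) :
    ∫ t in (-1 : ℝ)..1, (legendre q).eval t * g.eval t =
      g.coeff q / 2 ^ q * ∫ t in (-1 : ℝ)..1, (1 - t ^ 2) ^ q := by
  have iterate_derivative_g : derivative^[q] g = C (q.factorial * g.coeff q) := by
    rw [eq_C_of_natDegree_le_zero ((natDegree_iterate_derivative g q).trans (by lia)),
      coeff_iterate_derivative, zero_add, Nat.descFactorial_self, nsmul_eq_mul]
  rw [legendre_eq_iterate_derivative, integral_iterate_derivative_mul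
      (fun k => eval_iterate_derivative_C_mul_pow (by simp) _)
      (fun k => eval_iterate_derivative_C_mul_pow (by simp) _),
    iterate_derivative_g, ← intervalIntegral.integral_const_mul,
    ← intervalIntegral.integral_const_mul]
  congr 1 with t
  have : (1 - t ^ 2) ^ q = (-1) ^ q * (t ^ 2 - 1) ^ q := by rw [← mul_pow]; ring
  simp only [eval_mul, eval_C, eval_pow, eval_sub, eval_X, eval_one, this]
  field_simp

/-- The polynomial `(X ^ 2 - 1) P_q'` whose zeros are the Gauss-Lobatto nodes. -/
def lobattoPoly (q : ℕ) : ℝ[X] := (X ^ 2 - 1) * derivative (legendre q)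

theorem natDegree_X_sq_sub_one_mul_le {g : ℝ[X]} {n : ℕ} (hg : g.natDegree ≤ n) :
    ((X ^ 2 - 1) * g).natDegree ≤ n + 2 := by
  refine natDegree_mul_le.trans ?_
  rw [← C_1, natDegree_X_pow_sub_C]
  lia

theorem coeff_X_sq_sub_one_mul {g : ℝ[X]} {n : ℕ} (hg : g.natDegree ≤ n) :
    ((X ^ 2 - 1) * g).coeff (n + 2) = g.coeff n := by
  rw [sub_mul, one_mul, coeff_sub, coeff_X_pow_mul,
    coeff_eq_zero_of_natDegree_lt (n := n + 2) (by lia), sub_zero]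

theorem natDegree_derivative_legendre_succ_le (n : ℕ) :
    (derivative (legendre (n + 1))).natDegree ≤ n :=
  (natDegree_derivative_le _).trans (Nat.sub_le_of_le_add (natDegree_legendre_le _))

theorem coeff_lobattoPoly_pos (n : ℕ) : 0 < (lobattoPoly (n + 1)).coeff (n + 2) := by
  rw [lobattoPoly, coeff_X_sq_sub_one_mul (natDegree_derivative_legendre_succ_le n),
    coeff_derivative]
  have := coeff_legendre_pos (n + 1)
  positivity

theorem natDegree_lobattoPoly (n : ℕ) : (lobattoPoly (n + 1)).natDegree = n + 2 :=
  (natDegree_X_sq_sub_one_mul_le (natDegree_derivative_legendre_succ_le n)).antisymm <|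
    le_natDegree_of_ne_zero (coeff_lobattoPoly_pos n).ne'

theorem leadingCoeff_lobattoPoly_pos (n : ℕ) : 0 < (lobattoPoly (n + 1)).leadingCoeff := by
  rw [leadingCoeff, natDegree_lobattoPoly]
  exact coeff_lobattoPoly_pos n

theorem lobattoPoly_ne_zero (n : ℕ) : lobattoPoly (n + 1) ≠ 0 :=
  leadingCoeff_ne_zero.1 (leadingCoeff_lobattoPoly_pos n).ne'

theorem mem_glNodes_succ {n : ℕ} {x : ℝ} :
    x ∈ glNodes (n + 1) ↔ (lobattoPoly (n + 1)).eval x = 0 := by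
  rw [glNodes, Multiset.mem_toFinset, ← lobattoPoly, mem_roots (lobattoPoly_ne_zero n), IsRoot.def]

theorem card_glNodes_succ_le (n : ℕ) : #(glNodes (n + 1)) ≤ n + 2 :=
  (Multiset.toFinset_card_le _).trans <| (card_roots' _).trans (natDegree_lobattoPoly n).le

theorem le_card_filter_glNodes_succ (n : ℕ) :
    n + 2 ≤ #{x ∈ glNodes (n + 1) | x ∈ Set.Icc (-1) 1} := by
  classical
  obtain ⟨s, hs, hs0⟩ := exists_finset_legendre_eval_eq_zero (n + 1)
  obtain ⟨t, hst, ht⟩ := exists_finset_deriv_eq_zero (legendre (n + 1)).hasDerivAt s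
    fun x hx => ⟨Set.Ioo_subset_Icc_self (hs0 x hx).1, (hs0 x hx).2⟩
  have h1 : (-1 : ℝ) ∉ insert 1 t := by
    rw [mem_insert, not_or]
    exact ⟨by norm_num, fun h => lt_irrefl _ (ht _ h).1.1⟩
  have h2 : (1 : ℝ) ∉ t := fun h => lt_irrefl _ (ht _ h).1.2
  have hsub : insert (-1) (insert 1 t) ⊆ {x ∈ glNodes (n + 1) | x ∈ Set.Icc (-1) 1} := by
    intro x hx
    rw [mem_filter, mem_glNodes_succ, lobattoPoly, eval_mul]
    obtain rfl | rfl | hx : x = -1 ∨ x = 1 ∨ x ∈ t := by simpa using hx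
    · simp
    · simp
    · rw [(ht x hx).2, mul_zero]
      exact ⟨rfl, Set.Ioo_subset_Icc_self (ht x hx).1⟩
  have := card_le_card hsub
  rw [card_insert_of_notMem h1, card_insert_of_notMem h2] at this
  lia

theorem card_glNodes_succ (n : ℕ) : #(glNodes (n + 1)) = n + 2 :=
  (card_glNodes_succ_le n).antisymm <|
    (le_card_filter_glNodes_succ n).trans (card_filter_le _ _)

theorem glNodes_subset_Icc {q : ℕ} (hq : 1 ≤ q) {x : ℝ} (hx : x ∈ glNodes q) :
    x ∈ Set.Icc (-1 : ℝ) 1 := by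
  obtain ⟨n, rfl⟩ := Nat.exists_eq_add_of_le' hq
  refine filter_card_eq ?_ x hx
  exact (card_filter_le _ _).antisymm <|
    (card_glNodes_succ_le n).trans (le_card_filter_glNodes_succ n)

theorem integral_lobattoPoly_mul_nonpos {n : ℕ} {g : ℝ[X]} (hg : g.natDegree ≤ n)
    (hpos : 0 ≤ g.coeff n) :
    ∫ t in (-1 : ℝ)..1, (lobattoPoly (n + 1)).eval t * g.eval t ≤ 0 := by
  have parts := integral_derivative_mul (p := (X ^ 2 - 1) * g) (a := -1) (b := 1)
    (by simp) (by simp) (legendre (n + 1))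
  have coeff_top : (derivative ((X ^ 2 - 1) * g)).coeff (n + 1) = g.coeff n * (n + 2) := by
    rw [coeff_derivative, coeff_X_sq_sub_one_mul hg]
    push_cast
    ring
  have leg := integral_legendre_mul (q := n + 1) (g := derivative ((X ^ 2 - 1) * g))
    ((natDegree_derivative_le _).trans
      (Nat.sub_le_of_le_add (natDegree_X_sq_sub_one_mul_le hg)))
  have weight_nonneg : 0 ≤ ∫ t in (-1 : ℝ)..1, (1 - t ^ 2) ^ (n + 1) :=
    intervalIntegral.integral_nonneg (by norm_num) fun t ht =>
      pow_nonneg (by nlinarith [ht.1, ht.2]) _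
  calc ∫ t in (-1 : ℝ)..1, (lobattoPoly (n + 1)).eval t * g.eval t
      = ∫ t in (-1 : ℝ)..1, ((X ^ 2 - 1) * g).eval t * (derivative (legendre (n + 1))).eval t := by
        congr 1 with t
        simp only [lobattoPoly, eval_mul]
        ring
    _ = -∫ t in (-1 : ℝ)..1, (legendre (n + 1)).eval t * (derivative ((X ^ 2 - 1) * g)).eval t := by
        rw [← neg_eq_iff_eq_neg.2 parts]
        simp only [mul_comm]
    _ ≤ 0 := by
        rw [leg, coeff_top, neg_nonpos]
        positivity

theorem glLagrange_eval {q : ℕ} (a b : glNodes q) [Decidable (a = b)] :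
    (glLagrange q a).eval (b : ℝ) = if a = b then 1 else 0 := by
  classical
  split_ifs with h
  · subst h
    exact Lagrange.eval_basis_self (v := id) Function.injective_id.injOn a.2
  · exact Lagrange.eval_basis_of_ne (v := id) (Subtype.coe_injective.ne h) b.2

theorem sum_glWeight_mul_eval {q : ℕ} {r : ℝ[X]} (hr : r.degree < #(glNodes q)) :
    ∑ a, glWeight q a * r.eval (a : ℝ) = ∫ t in (-1 : ℝ)..1, r.eval t := by
  have interpolation : r = ∑ a : glNodes q, C (r.eval (a : ℝ)) * glLagrange q a := by
    have := Lagrange.eq_interpolate (v := id) Function.injective_id.injOn hr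
    rwa [Lagrange.interpolate_apply, ← sum_coe_sort] at this
  conv_rhs => rw [interpolation]
  simp only [eval_finsetSum, eval_mul, eval_C]
  rw [intervalIntegral.integral_finsetSum
    fun a _ => ((glLagrange q a).continuous.const_mul _).intervalIntegrable _ _]
  simp only [intervalIntegral.integral_const_mul, glWeight, mul_comm]

theorem natDegree_div_le {K : Type*} [Field K] (f : K[X]) {w : K[X]} (hw : w ≠ 0) :
    (f / w).natDegree ≤ f.natDegree - w.natDegree := by
  rw [Polynomial.div_def]
  refine (natDegree_C_mul_le _ _).trans_eq ?_
  rw [natDegree_divByMonic f (monic_mul_leadingCoeff_inv hw), natDegree_mul_leadingCoeff_inv w hw]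

theorem leadingCoeff_mul_coeff_div {K : Type*} [Field K] {f w : K[X]} (hw : w ≠ 0) {n : ℕ}
    (hf : f.natDegree ≤ w.natDegree + n) :
    w.leadingCoeff * (f / w).coeff n = f.coeff (w.natDegree + n) := by
  have natDegree_quot : (f / w).natDegree ≤ n := (natDegree_div_le f hw).trans (by lia)
  have coeff_rem : (f % w).coeff (w.natDegree + n) = 0 :=
    coeff_eq_zero_of_degree_lt <| (EuclideanDomain.mod_lt f hw).trans_le <|
      degree_le_natDegree.trans (by exact_mod_cast Nat.le_add_right _ _)
  conv_rhs => rw [← EuclideanDomain.div_add_mod f w]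
  rw [coeff_add, coeff_rem, add_zero, coeff_mul_add_eq_of_natDegree_le le_rfl natDegree_quot,
    coeff_natDegree]

theorem integral_sq_le_sum_glWeight {q : ℕ} (hq : 1 ≤ q) {p : ℝ[X]} (hp : p.natDegree ≤ q) :
    ∫ t in (-1 : ℝ)..1, p.eval t ^ 2 ≤ ∑ a, glWeight q a * p.eval (a : ℝ) ^ 2 := by
  obtain ⟨n, rfl⟩ := Nat.exists_eq_add_of_le' hq
  set w := lobattoPoly (n + 1)
  have hw : w ≠ 0 := lobattoPoly_ne_zero n
  have hdeg : (p * p).natDegree ≤ w.natDegree + n := by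
    rw [natDegree_lobattoPoly]
    exact natDegree_mul_le.trans (by lia)
  have rem_degree : (p * p % w).degree < #(glNodes (n + 1)) := by
    rw [card_glNodes_succ, ← natDegree_lobattoPoly, ← degree_eq_natDegree hw]
    exact EuclideanDomain.mod_lt _ hw
  have quot_degree : (p * p / w).natDegree ≤ n := (natDegree_div_le _ hw).trans (by lia)
  have quot_coeff : 0 ≤ (p * p / w).coeff n := by
    rw [← mul_nonneg_iff_of_pos_left (leadingCoeff_lobattoPoly_pos n),
      leadingCoeff_mul_coeff_div hw hdeg, natDegree_lobattoPoly,
      show n + 2 + n = (n + 1) + (n + 1) by lia, coeff_mul_add_eq_of_natDegree_le hp hp]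
    exact mul_self_nonneg _
  have sq_eval (t : ℝ) : p.eval t ^ 2 = w.eval t * (p * p / w).eval t + (p * p % w).eval t := by
    rw [sq, ← eval_mul, ← eval_mul, ← eval_add, EuclideanDomain.div_add_mod]
  have sq_eval_node (a : glNodes (n + 1)) : p.eval (a : ℝ) ^ 2 = (p * p % w).eval (a : ℝ) := by
    rw [sq_eval, mem_glNodes_succ.1 a.2, zero_mul, zero_add]
  simp only [sq_eval_node, sum_glWeight_mul_eval rem_degree, sq_eval]
  rw [intervalIntegral.integral_add (Continuous.intervalIntegrable (by fun_prop) _ _)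
    (Continuous.intervalIntegrable (by fun_prop) _ _)]
  exact add_le_of_nonpos_left (integral_lobattoPoly_mul_nonpos quot_degree quot_coeff)

end GaussLobatto

/-! ## Mass matrix of the reference element -/

section ReferenceElement

open Polynomial Matrix MeasureTheory

theorem dotProduct_integral_mulVec {X n : Type*} [MeasurableSpace X] {μ : Measure X} [Fintype n]
    {A : X → Matrix n n ℝ} (hA : ∀ i j, Integrable (A · i j) μ) (y z : n → ℝ) :
    y ⬝ᵥ (of fun i j => ∫ x, A x i j ∂μ) *ᵥ z = ∫ x, y ⬝ᵥ A x *ᵥ z ∂μ := by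
  have row (i : n) : Integrable (fun x => ∑ j, A x i j * z j) μ :=
    integrable_finsetSum _ fun j _ => (hA i j).mul_const _
  simp only [dotProduct, mulVec, of_apply]
  rw [integral_finsetSum _ fun i _ => (row i).const_mul _]
  simp_rw [integral_const_mul, integral_finsetSum _ fun j _ => (hA _ j).mul_const _,
    integral_mul_const]

theorem posSemidef_integral {X n : Type*} [MeasurableSpace X] {μ : Measure X} [Finite n]
    {A : X → Matrix n n ℝ} (hA : ∀ i j, Integrable (A · i j) μ)
    (hpos : ∀ᵐ x ∂μ, (A x).PosSemidef) : (of fun i j => ∫ x, A x i j ∂μ).PosSemidef := by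
  have := Fintype.ofFinite n
  refine .of_dotProduct_mulVec_nonneg (IsHermitian.ext fun i j => ?_) fun y => ?_
  · exact integral_congr_ae (hpos.mono fun x hx => hx.isHermitian.apply i j)
  · rw [dotProduct_integral_mulVec hA]
    exact integral_nonneg_of_ae (hpos.mono fun x hx => hx.dotProduct_mulVec_nonneg y)

/-- The Gram matrix of a family of real functions for the inner product of `L²(μ)`. -/
def gramL2 {X n : Type*} [MeasurableSpace X] (μ : Measure X) (f : n → X → ℝ) : Matrix n n ℝ :=
  of fun i j => ∫ x, f i x * f j x ∂μ

theorem dotProduct_gramL2_mulVec {X n : Type*} [MeasurableSpace X] {μ : Measure X} [Fintype n]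
    {f : n → X → ℝ} (hf : ∀ i j, Integrable (fun x => f i x * f j x) μ) (y z : n → ℝ) :
    y ⬝ᵥ gramL2 μ f *ᵥ z = ∫ x, (∑ i, y i * f i x) * ∑ i, z i * f i x ∂μ := by
  refine (dotProduct_integral_mulVec (A := fun x => vecMulVec (f · x) (f · x)) hf y z).trans ?_
  congr 1 with x
  have dotProduct_f (w : n → ℝ) : w ⬝ᵥ (f · x) = ∑ i, w i * f i x := rfl
  rw [vecMulVec_mulVec, dotProduct_smul, dotProduct_comm (f · x), dotProduct_f, dotProduct_f,
    op_smul_eq_mul]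

theorem gramL2_sum_mul {X m n : Type*} [MeasurableSpace X] {μ : Measure X} [Fintype m]
    {f : m → X → ℝ} (hf : ∀ i j, Integrable (fun x => f i x * f j x) μ) (B : Matrix m n ℝ) :
    gramL2 μ (fun j x => ∑ k, B k j * f k x) = Bᵀ * gramL2 μ f * B := by
  ext i j
  rw [Matrix.mul_assoc]
  exact (dotProduct_gramL2_mulVec hf (B.col i) (B.col j)).symm

theorem gramL2_posSemidef {X n : Type*} [MeasurableSpace X] {μ : Measure X} [Finite n]
    {f : n → X → ℝ} (hf : ∀ i j, Integrable (fun x => f i x * f j x) μ) :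
    (gramL2 μ f).PosSemidef :=
  posSemidef_integral hf (.of_forall fun x => posSemidef_vecMulVec_self_star (f · x))

theorem eqOn_zero_of_setIntegral_sq_eq_zero {X : Type*} [TopologicalSpace X] [MeasurableSpace X]
    [OpensMeasurableSpace X] {μ : Measure X} [μ.IsOpenPosMeasure] [IsFiniteMeasureOnCompacts μ]
    {K : Set X} (hK : IsCompact K) (hKm : MeasurableSet K) (hint : K ⊆ closure (interior K))
    {f : X → ℝ} (hf : Continuous f) (h0 : ∫ x in K, f x ^ 2 ∂μ = 0) :
    Set.EqOn f 0 K := by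
  have hae := (setIntegral_eq_zero_iff_of_nonneg_ae (.of_forall fun x => sq_nonneg (f x))
    ((hf.pow 2).continuousOn.integrableOn_compact' hK hKm)).1 h0
  exact Measure.eqOn_of_ae_eq (hae.mono fun x hx => pow_eq_zero_iff two_ne_zero |>.1 hx)
    hf.continuousOn continuousOn_const hint

theorem posSemidef_prod {ι n : Type*} [Finite n] {A : ι → Matrix n n ℝ} (s : Finset ι)
    (hA : ∀ i ∈ s, (A i).PosSemidef) : (of fun k l => ∏ i ∈ s, A i k l).PosSemidef := by
  classical
  induction s using Finset.induction_on with
  | empty => simpa [vecMulVec] using posSemidef_vecMulVec_self_star (1 : n → ℝ)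
  | insert i s hi ih =>
    simp only [Finset.prod_insert hi]
    exact (hA i (by simp)).hadamard (ih fun j hj => hA j (by simp [hj]))

theorem posSemidef_prod_sub_prod {ι n : Type*} [Finite n] {A B : ι → Matrix n n ℝ}
    (s : Finset ι) (hB : ∀ i ∈ s, (B i).PosSemidef) (hAB : ∀ i ∈ s, (A i - B i).PosSemidef) :
    ((of fun k l => ∏ i ∈ s, A i k l) - of fun k l => ∏ i ∈ s, B i k l).PosSemidef := by
  classical
  induction s using Finset.induction_on with
  | empty => simpa using PosSemidef.zero
  | insert i s hi ih =>
    have hA (j) (hj : j ∈ s) : (A j).PosSemidef := by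
      simpa using (hAB j (by simp [hj])).add (hB j (by simp [hj]))
    have telescope : ((of fun k l => ∏ j ∈ insert i s, A j k l) -
          of fun k l => ∏ j ∈ insert i s, B j k l) =
        (A i - B i) ⊙ (of fun k l => ∏ j ∈ s, A j k l) +
          B i ⊙ ((of fun k l => ∏ j ∈ s, A j k l) -
            of fun k l => ∏ j ∈ s, B j k l) := by
      ext k l
      simp only [Finset.prod_insert hi, Matrix.sub_apply, of_apply, Matrix.add_apply,
        hadamard_apply]
      ring
    rw [telescope]
    exact ((hAB i (by simp)).hadamard (posSemidef_prod s hA)).add <|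
      (hB i (by simp)).hadamard <|
        ih (fun j hj => hB j (by simp [hj])) fun j hj => hAB j (by simp [hj])

/-- The mass matrix of the one-dimensional Lagrange basis of degree `q` on `[-1, 1]`. -/
def lineMass (q : ℕ) : Matrix (glNodes q) (glNodes q) ℝ :=
  gramL2 (volume.restrict (Set.Icc (-1) 1)) fun a t => (glLagrange q a).eval t

theorem integrable_glLagrange_mul {q : ℕ} (a b : glNodes q) :
    IntegrableOn (fun t => (glLagrange q a).eval t * (glLagrange q b).eval t)
      (Set.Icc (-1 : ℝ) 1) :=
  ((glLagrange q a).continuous.mul (glLagrange q b).continuous).integrableOn_Icc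

theorem lineMass_posSemidef (q : ℕ) : (lineMass q).PosSemidef :=
  gramL2_posSemidef integrable_glLagrange_mul

theorem diagonal_glWeight_sub_lineMass_posSemidef {q : ℕ} (hq : 1 ≤ q) :
    (diagonal (glWeight q) - lineMass q).PosSemidef := by
  refine .of_dotProduct_mulVec_nonneg
    ((isHermitian_diagonal _).sub (lineMass_posSemidef q).isHermitian) fun y => ?_
  set p : ℝ[X] := ∑ a, C (y a) * glLagrange q a
  have natDegree_p : p.natDegree ≤ q := by
    obtain ⟨n, rfl⟩ := Nat.exists_eq_add_of_le' hq
    refine natDegree_sum_le_of_forall_le _ _ fun a _ => (natDegree_C_mul_le _ _).trans_eq ?_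
    rw [glLagrange, Lagrange.natDegree_basis Function.injective_id.injOn a.2, card_glNodes_succ]
    lia
  have eval_p (t : ℝ) : p.eval t = ∑ a, y a * (glLagrange q a).eval t := by
    simp [p, eval_finsetSum]
  have eval_p_node (a : glNodes q) : p.eval (a : ℝ) = y a := by
    classical
    simp [eval_p, glLagrange_eval]
  rw [star_trivial, sub_mulVec, dotProduct_sub, sub_nonneg, lineMass,
    dotProduct_gramL2_mulVec integrable_glLagrange_mul]
  simp only [← sq]
  calc ∫ t in Set.Icc (-1) 1, (∑ a, y a * (glLagrange q a).eval t) ^ 2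
      = ∫ t in (-1 : ℝ)..1, p.eval t ^ 2 := by
        rw [integral_Icc_eq_integral_Ioc, intervalIntegral.integral_of_le (by norm_num)]
        simp only [eval_p]
    _ ≤ ∑ a, glWeight q a * p.eval (a : ℝ) ^ 2 := integral_sq_le_sum_glWeight hq natDegree_p
    _ = y ⬝ᵥ diagonal (glWeight q) *ᵥ y := by
        simp only [eval_p_node, dotProduct, mulVec_diagonal]
        exact Finset.sum_congr rfl fun a _ => by ring

variable {d : ℕ} {q : Fin d → ℕ}

theorem refCube_eq_preimage :
    refCube d = WithLp.ofLp ⁻¹' (Set.univ.pi fun _ : Fin d => Set.Icc (-1 : ℝ) 1) := by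
  ext x
  exact Set.mem_univ_pi.symm

theorem convex_refCube : Convex ℝ (refCube d) := by
  rw [refCube_eq_preimage]
  exact (convex_pi fun _ _ => convex_Icc _ _).linear_preimage
    (WithLp.linearEquiv 2 ℝ (Fin d → ℝ)).toLinearMap

theorem isCompact_refCube : IsCompact (refCube d) := by
  rw [refCube_eq_preimage]
  exact (PiLp.homeomorph 2 fun _ : Fin d => ℝ).isCompact_preimage.2
    (isCompact_univ_pi fun _ => isCompact_Icc)

theorem interior_refCube_nonempty : (interior (refCube d)).Nonempty := by
  rw [refCube_eq_preimage]
  refine ⟨0, preimage_interior_subset_interior_preimage (PiLp.continuous_ofLp 2 _) ?_⟩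
  simp [interior_pi_set Set.finite_univ, -Set.pi_univ_Icc]

theorem continuous_refBasis (k : LocalIndex q) : Continuous (refBasis k) := by
  unfold refBasis
  fun_prop

theorem refBasis_refNode (k l : LocalIndex q) [Decidable (k = l)] :
    refBasis k (refNode l) = if k = l then 1 else 0 := by
  classical
  simp only [refBasis, refNode, glLagrange_eval, Finset.prod_ite_zero, Finset.prod_const_one,
    Finset.mem_univ, forall_const, funext_iff]

theorem refNode_mem_refCube (hq : ∀ j, 1 ≤ q j) (k : LocalIndex q) : refNode k ∈ refCube d :=
  fun j => glNodes_subset_Icc (hq j) (k j).2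

/-- The mass matrix of the tensor-product Lagrange basis on the reference element. -/
def refMass (q : Fin d → ℕ) : Matrix (LocalIndex q) (LocalIndex q) ℝ :=
  gramL2 (volume.restrict (refCube d)) refBasis

theorem integrable_refBasis_mul (k l : LocalIndex q) :
    IntegrableOn (fun x => refBasis k x * refBasis l x) (refCube d) :=
  ((continuous_refBasis k).mul (continuous_refBasis l)).continuousOn.integrableOn_compact
    isCompact_refCube

theorem refMass_apply (k l : LocalIndex q) :
    refMass q k l = ∏ j, lineMass (q j) (k j) (l j) := by
  let f (j : Fin d) (t : ℝ) := (glLagrange (q j) (k j)).eval t * (glLagrange (q j) (l j)).eval t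
  calc refMass q k l = ∫ x in refCube d, ∏ j, f j (x j) := by
        simp only [refMass, gramL2, of_apply, refBasis, ← Finset.prod_mul_distrib, f]
    _ = ∫ y in Set.univ.pi fun _ => Set.Icc (-1) 1, ∏ j, f j (y j) := by
        rw [refCube_eq_preimage]
        exact (PiLp.volume_preserving_ofLp (Fin d)).setIntegral_preimage_emb
          (MeasurableEquiv.toLp 2 (Fin d → ℝ)).symm.measurableEmbedding
          (fun y => ∏ j, f j (y j)) _
    _ = ∏ j, lineMass (q j) (k j) (l j) := by
        rw [volume_pi, Measure.restrict_pi_pi, integral_fintype_prod_eq_prod]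
        rfl

theorem refMass_posSemidef : (refMass q).PosSemidef :=
  gramL2_posSemidef integrable_refBasis_mul

theorem refMass_posDef (hq : ∀ j, 1 ≤ q j) : (refMass q).PosDef := by
  classical
  refine .of_dotProduct_mulVec_pos refMass_posSemidef.isHermitian fun y hy => ?_
  refine (refMass_posSemidef.dotProduct_mulVec_nonneg y).lt_of_ne' fun h0 => hy (funext fun k => ?_)
  rw [star_trivial, refMass, dotProduct_gramL2_mulVec integrable_refBasis_mul] at h0
  simp only [← sq] at h0
  have vanish : Set.EqOn (fun x => ∑ l, y l * refBasis l x) 0 (refCube d) :=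
    eqOn_zero_of_setIntegral_sq_eq_zero isCompact_refCube isCompact_refCube.measurableSet
      (by
        rw [convex_refCube.closure_interior_eq_closure_of_nonempty_interior
          interior_refCube_nonempty]
        exact subset_closure)
      (continuous_finsetSum _ fun l _ => (continuous_refBasis l).const_mul _) h0
  simpa [refBasis_refNode] using vanish (refNode_mem_refCube hq k)

theorem diagonal_refWeight_sub_refMass_posSemidef (hq : ∀ j, 1 ≤ q j) :
    (diagonal refWeight - refMass q).PosSemidef := by
  let restrict (j : Fin d) (k : LocalIndex q) := k j
  convert posSemidef_prod_sub_prod Finset.univ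
    (fun j _ => (lineMass_posSemidef (q j)).submatrix (restrict j))
    (fun j _ => (diagonal_glWeight_sub_lineMass_posSemidef (hq j)).submatrix (restrict j)) using 2
  · ext k l
    simp [diagonal_apply, refWeight, Finset.prod_ite_zero, funext_iff, restrict]
  · ext k l
    exact refMass_apply k l

end ReferenceElement

/-! ## Finite element assembly -/

section Assembly

open Matrix MeasureTheory

variable {d : ℕ} {q : Fin d → ℕ}

theorem contDiff_affineEquiv {V W : Type*} [NormedAddCommGroup V] [NormedSpace ℝ V]
    [FiniteDimensional ℝ V] [NormedAddCommGroup W] [NormedSpace ℝ W] (F : V ≃ᵃ[ℝ] W)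
    {n : WithTop ℕ∞} : ContDiff ℝ n F :=
  F.toContinuousAffineEquiv.toContinuousAffineMap.contDiff

theorem setIntegral_image_affineEquiv {V W : Type*} [NormedAddCommGroup V] [NormedSpace ℝ V]
    [FiniteDimensional ℝ V] [MeasurableSpace V] [BorelSpace V] [NormedAddCommGroup W]
    [NormedSpace ℝ W] (μ : Measure V) [μ.IsAddHaarMeasure] {s : Set V} (hs : MeasurableSet s)
    (F : V ≃ᵃ[ℝ] V) (f : V → W) :
    ∫ x in F '' s, f x ∂μ = |LinearMap.det (F.linear : V →ₗ[ℝ] V)| • ∫ y in s, f (F y) ∂μ := by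
  have hasFDerivAt (x : V) := F.toContinuousAffineEquiv.toContinuousAffineMap.hasFDerivAt (x := x)
  rw [← integral_smul]
  exact integral_image_eq_integral_abs_det_fderiv_smul μ hs
    (fun x _ => (hasFDerivAt x).hasFDerivWithinAt) F.injective.injOn f

theorem contDiff_refBasis (k : LocalIndex q) {n : WithTop ℕ∞} : ContDiff ℝ n (refBasis k) := by
  unfold refBasis
  refine contDiff_prod fun j _ => ?_
  have contDiff_eval := Polynomial.contDiff_aeval (𝕜 := ℝ) (glLagrange (q j) (k j)) n
  simpa [Function.comp_def] using contDiff_eval.comp (contDiff_euclidean.1 contDiff_id j)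

theorem contDiff_elementBasis (F : EuclideanSpace ℝ (Fin d) ≃ᵃ[ℝ] EuclideanSpace ℝ (Fin d))
    (z : EuclideanSpace ℝ (Fin d)) {n : WithTop ℕ∞} : ContDiff ℝ n (elementBasis q F z) := by
  unfold elementBasis
  refine ContDiff.sum fun k _ => ?_
  split_ifs
  · exact (contDiff_refBasis k).comp (contDiff_affineEquiv F.symm)
  · exact contDiff_const

theorem continuous_gradient_elementBasis
    (F : EuclideanSpace ℝ (Fin d) ≃ᵃ[ℝ] EuclideanSpace ℝ (Fin d))
    (z : EuclideanSpace ℝ (Fin d)) : Continuous (gradient (elementBasis q F z)) :=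
  (LinearIsometryEquiv.continuous _).comp
    ((contDiff_elementBasis F z).continuous_fderiv one_ne_zero)

namespace Mesh

variable {E : Type*} (T : Mesh d q E)

theorem convex_element (e : E) : Convex ℝ (T.element e) :=
  convex_refCube.affine_image (T.map e : EuclideanSpace ℝ (Fin d) →ᵃ[ℝ] EuclideanSpace ℝ (Fin d))

theorem isCompact_element (e : E) : IsCompact (T.element e) :=
  isCompact_refCube.image (contDiff_affineEquiv (T.map e) (n := 0)).continuous

theorem absJac_pos (e : E) : 0 < T.absJac e :=
  abs_pos.2 (LinearEquiv.isUnit_det' (T.map e).linear).ne_zero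

theorem interior_ae_eq_element (e : E) :
    (interior (T.element e) : Set _) =ᵐ[volume] T.element e :=
  interior_ae_eq_of_null_frontier ((T.convex_element e).addHaar_frontier volume)

theorem ae_mem_interior (e : E) :
    ∀ᵐ x ∂volume.restrict (T.element e), x ∈ interior (T.element e) := by
  rw [← Measure.restrict_congr_set (T.interior_ae_eq_element e)]
  exact ae_restrict_mem isOpen_interior.measurableSet

theorem setIntegral_domain [Fintype E] {f : EuclideanSpace ℝ (Fin d) → ℝ}
    (hf : ∀ e, IntegrableOn f (T.element e)) :
    ∫ x in T.domain, f x = ∑ e, ∫ x in T.element e, f x := by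
  rw [domain, integral_iUnion_ae (fun e => (T.isCompact_element e).measurableSet.nullMeasurableSet)
    _ (integrableOn_finite_iUnion.2 hf), tsum_fintype]
  intro e e' h
  exact (T.disjoint_interior h).aedisjoint.congr (T.interior_ae_eq_element e).symm
    (T.interior_ae_eq_element e').symm

theorem gradient_basis_eq {e : E} {x : EuclideanSpace ℝ (Fin d)}
    (hx : x ∈ interior (T.element e)) (z : EuclideanSpace ℝ (Fin d)) :
    gradient (T.basis z) x = gradient (elementBasis q (T.map e) z) x := by
  have : T.basis z =ᶠ[nhds x] elementBasis q (T.map e) z := by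
    filter_upwards [mem_interior_iff_mem_nhds.1 hx] with y hy
    exact T.basis_eq_elementBasis z hy
  rw [gradient, gradient, this.fderiv_eq]

theorem integrableOn_stiffness [Finite E] {κ : EuclideanSpace ℝ (Fin d) → ℝ}
    (hκint : IntegrableOn κ T.domain) (z w : EuclideanSpace ℝ (Fin d)) :
    IntegrableOn (fun x => κ x * inner ℝ (gradient (T.basis z) x) (gradient (T.basis w) x))
      T.domain := by
  refine integrableOn_finite_iUnion.2 fun e => ?_
  have h : IntegrableOn (fun x => κ x * inner ℝ (gradient (elementBasis q (T.map e) z) x)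
      (gradient (elementBasis q (T.map e) w) x)) (T.element e) :=
    (hκint.mono_set (Set.subset_iUnion _ e)).mul_continuousOn
      ((continuous_gradient_elementBasis _ _).inner
        (continuous_gradient_elementBasis _ _)).continuousOn (T.isCompact_element e)
  refine h.congr_fun_ae ?_
  filter_upwards [T.ae_mem_interior e] with x hx
  rw [T.gradient_basis_eq hx, T.gradient_basis_eq hx]

variable [Fintype E] (Γ : Set (EuclideanSpace ℝ (Fin d)))

open Classical in
/-- The Boolean matrix that restricts global nodal values to the local nodes of the element `e`. -/
def incidence (e : E) : Matrix (LocalIndex q) (T.freeNodes Γ) ℝ :=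
  of fun k i => if T.map e (refNode k) = i then 1 else 0

theorem elementBasis_map (e : E) (i : T.freeNodes Γ) (y : EuclideanSpace ℝ (Fin d)) :
    elementBasis q (T.map e) i (T.map e y) = ∑ k, T.incidence Γ e k i * refBasis k y := by
  simp [elementBasis, incidence]

theorem basis_map_refNode (hq : ∀ j, 1 ≤ q j) (e : E) (i : T.freeNodes Γ) (k : LocalIndex q) :
    T.basis i (T.map e (refNode k)) = T.incidence Γ e k i := by
  classical
  rw [T.basis_eq_elementBasis _ (Set.mem_image_of_mem _ (refNode_mem_refCube hq k)),
    elementBasis_map]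
  simp [refBasis_refNode]

theorem exists_incidence_mulVec_ne_zero {y : T.freeNodes Γ → ℝ} (hy : y ≠ 0) :
    ∃ e, T.incidence Γ e *ᵥ y ≠ 0 := by
  obtain ⟨i, hi⟩ := Function.ne_iff.1 hy
  have hnode := i.2
  simp only [freeNodes, Finset.mem_filter, Finset.mem_image, Finset.mem_univ, true_and] at hnode
  obtain ⟨⟨⟨e, k⟩, hk⟩, -⟩ := hnode
  refine ⟨e, Function.ne_iff.2 ⟨k, ?_⟩⟩
  simpa [mulVec, dotProduct, incidence, hk, Subtype.coe_inj] using hi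

/-- The finite element assembly of the global matrix whose contribution from the element `e` is
`c e` times the reference element matrix `A`. -/
def assemble (c : E → ℝ) (A : Matrix (LocalIndex q) (LocalIndex q) ℝ) :
    Matrix (T.freeNodes Γ) (T.freeNodes Γ) ℝ :=
  ∑ e, c e • ((T.incidence Γ e)ᵀ * A * T.incidence Γ e)

theorem assemble_sub (c : E → ℝ) (A B : Matrix (LocalIndex q) (LocalIndex q) ℝ) :
    T.assemble Γ c (A - B) = T.assemble Γ c A - T.assemble Γ c B := by
  simp only [assemble, Matrix.mul_sub, Matrix.sub_mul, smul_sub, Finset.sum_sub_distrib]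

theorem dotProduct_assemble_mulVec (c : E → ℝ) (A : Matrix (LocalIndex q) (LocalIndex q) ℝ)
    (y : T.freeNodes Γ → ℝ) : y ⬝ᵥ T.assemble Γ c A *ᵥ y =
      ∑ e, c e * ((T.incidence Γ e *ᵥ y) ⬝ᵥ A *ᵥ (T.incidence Γ e *ᵥ y)) := by
  rw [assemble, sum_mulVec, dotProduct_sum]
  refine Finset.sum_congr rfl fun e _ => ?_
  rw [smul_mulVec, dotProduct_smul, smul_eq_mul, ← mulVec_mulVec, ← mulVec_mulVec,
    dotProduct_mulVec, vecMul_transpose]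

variable {c : E → ℝ} {A : Matrix (LocalIndex q) (LocalIndex q) ℝ}

theorem assemble_posSemidef (hc : ∀ e, 0 ≤ c e) (hA : A.PosSemidef) :
    (T.assemble Γ c A).PosSemidef :=
  posSemidef_sum _ fun e _ => by
    rw [← conjTranspose_eq_transpose_of_trivial]
    exact (hA.conjTranspose_mul_mul_same _).smul (hc e)

theorem assemble_posDef (hc : ∀ e, 0 < c e) (hA : A.PosDef) : (T.assemble Γ c A).PosDef := by
  refine .of_dotProduct_mulVec_pos
    (T.assemble_posSemidef Γ (fun e => (hc e).le) hA.posSemidef).isHermitian fun y hy => ?_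
  obtain ⟨e, he⟩ := T.exists_incidence_mulVec_ne_zero Γ hy
  rw [star_trivial, dotProduct_assemble_mulVec]
  exact Finset.sum_pos'
    (fun e _ => mul_nonneg (hc e).le (hA.posSemidef.dotProduct_mulVec_nonneg _))
    ⟨e, Finset.mem_univ e, mul_pos (hc e) (hA.dotProduct_mulVec_pos he)⟩

variable {ρ : EuclideanSpace ℝ (Fin d) → ℝ} {ρe : E → ℝ}

theorem massMatrix_eq_assemble (hρ : ∀ e, ∀ x ∈ interior (T.element e), ρ x = ρe e) :
    T.massMatrix Γ ρ = T.assemble Γ (fun e => ρe e * T.absJac e) (refMass q) := by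
  ext i j
  have on_element (e) : (fun x => ρ x * T.basis i x * T.basis j x)
      =ᵐ[volume.restrict (T.element e)] fun x => ρe e *
        (elementBasis q (T.map e) i x * elementBasis q (T.map e) j x) := by
    filter_upwards [T.ae_mem_interior e] with x hx
    rw [hρ e x hx, T.basis_eq_elementBasis _ (interior_subset hx),
      T.basis_eq_elementBasis _ (interior_subset hx), mul_assoc]
  have integrable (e) : IntegrableOn (fun x => ρ x * T.basis i x * T.basis j x) (T.element e) :=
    have smooth (z) := contDiff_elementBasis (q := q) (T.map e) z (n := 0)
    IntegrableOn.congr_fun_ae ((continuous_const.mul ((smooth i).continuous.mul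
      (smooth j).continuous)).continuousOn.integrableOn_compact (T.isCompact_element e))
      (on_element e).symm
  rw [massMatrix, of_apply, massForm, T.setIntegral_domain integrable, assemble, Matrix.sum_apply]
  refine Finset.sum_congr rfl fun e _ => ?_
  calc ∫ x in T.element e, ρ x * T.basis i x * T.basis j x
      = ρe e * T.absJac e * ∫ y in refCube d,
          elementBasis q (T.map e) i (T.map e y) * elementBasis q (T.map e) j (T.map e y) := by
        rw [integral_congr_ae (on_element e), integral_const_mul, element,
          setIntegral_image_affineEquiv _ isCompact_refCube.measurableSet, smul_eq_mul, mul_assoc]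
        rfl
    _ = ((ρe e * T.absJac e) •
          ((T.incidence Γ e)ᵀ * refMass q * T.incidence Γ e)) i j := by
        rw [refMass, ← gramL2_sum_mul integrable_refBasis_mul]
        simp only [elementBasis_map, Matrix.smul_apply, gramL2, of_apply, smul_eq_mul]

theorem lumpedMatrix_eq_assemble (hq : ∀ j, 1 ≤ q j) : T.lumpedMatrix Γ ρe =
    T.assemble Γ (fun e => ρe e * T.absJac e) (diagonal refWeight) := by
  ext i j
  rw [lumpedMatrix, of_apply, lumpedForm, assemble, Matrix.sum_apply]
  refine Finset.sum_congr rfl fun e _ => ?_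
  rw [Matrix.smul_apply, smul_eq_mul, mul_apply, Finset.mul_sum]
  refine Finset.sum_congr rfl fun k _ => ?_
  rw [mul_diagonal, transpose_apply, T.basis_map_refNode Γ hq, T.basis_map_refNode Γ hq]
  ring

theorem massMatrix_posDef (hq : ∀ j, 1 ≤ q j)
    (hρ : ∀ e, ∀ x ∈ interior (T.element e), ρ x = ρe e) (hρpos : ∀ e, 0 < ρe e) :
    (T.massMatrix Γ ρ).PosDef := by
  rw [T.massMatrix_eq_assemble Γ hρ]
  exact T.assemble_posDef Γ (fun e => mul_pos (hρpos e) (T.absJac_pos e)) (refMass_posDef hq)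

theorem lumpedMatrix_sub_massMatrix_posSemidef (hq : ∀ j, 1 ≤ q j)
    (hρ : ∀ e, ∀ x ∈ interior (T.element e), ρ x = ρe e) (hρnonneg : ∀ e, 0 ≤ ρe e) :
    (T.lumpedMatrix Γ ρe - T.massMatrix Γ ρ).PosSemidef := by
  rw [T.massMatrix_eq_assemble Γ hρ, T.lumpedMatrix_eq_assemble Γ hq, ← assemble_sub]
  exact T.assemble_posSemidef Γ (fun e => mul_nonneg (hρnonneg e) (T.absJac_pos e).le)
    (diagonal_refWeight_sub_refMass_posSemidef hq)

theorem stiffMatrix_posSemidef {κ : EuclideanSpace ℝ (Fin d) → ℝ} (hκ : ∀ x ∈ T.domain, 0 ≤ κ x)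
    (hκint : IntegrableOn κ T.domain) :
    (T.stiffMatrix Γ κ).PosSemidef := by
  have measurableSet_domain : MeasurableSet T.domain :=
    MeasurableSet.iUnion fun e => (T.isCompact_element e).measurableSet
  exact posSemidef_integral
    (A := fun x => κ x • gram ℝ fun i : T.freeNodes Γ => gradient (T.basis i) x)
    (fun i j => T.integrableOn_stiffness hκint i j)
    ((ae_restrict_mem measurableSet_domain).mono fun x hx => (posSemidef_gram ℝ _).smul (hκ x hx))

end Mesh

end Assembly

/-! ## Monotonicity of generalized eigenvalues -/

section Pencil

open Polynomial Matrix

theorem getElem_le_iff_lt_countP {α : Type*} [LinearOrder α] {l : List α}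
    (hl : l.Pairwise (· ≤ ·)) {k : ℕ} (hk : k < l.length) {t : α} :
    l[k] ≤ t ↔ k < l.countP (· ≤ t) := by
  induction l generalizing k with
  | nil => simp at hk
  | cons a l ih =>
    obtain ⟨head_le, hl⟩ := List.pairwise_cons.1 hl
    rcases le_or_gt a t with hat | hat
    · cases k with
      | zero => simp [hat]
      | succ k => simpa [hat] using ih hl (Nat.lt_of_succ_lt_succ hk)
    · have all_gt (b) (hb : b ∈ a :: l) : t < b := by
        rcases List.mem_cons.1 hb with rfl | hb
        exacts [hat, hat.trans_le (head_le b hb)]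
      have countP_eq_zero : (a :: l).countP (· ≤ t) = 0 :=
        List.countP_eq_zero.2 fun b hb => by simpa using all_gt b hb
      simpa [countP_eq_zero] using all_gt _ (List.getElem_mem hk)

variable {n : Type*} [Fintype n]

open scoped ComplexOrder MatrixOrder in
theorem exists_conjTranspose_mul_mul_eq_one_eq_diagonal {𝕜 : Type*} [RCLike 𝕜] [DecidableEq n]
    {A B : Matrix n n 𝕜} (hA : A.IsHermitian) (hB : B.PosDef) :
    ∃ (S : Matrix n n 𝕜) (D : n → ℝ),
      Sᴴ * B * S = 1 ∧ Sᴴ * A * S = diagonal (RCLike.ofReal ∘ D) := by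
  obtain ⟨R, hR, rfl⟩ := CStarAlgebra.isStrictlyPositive_iff_eq_star_mul_self.1
    hB.isStrictlyPositive
  have hRinv : R * R⁻¹ = 1 := mul_nonsing_inv R ((isUnit_iff_isUnit_det R).1 hR)
  have hH : (R⁻¹ᴴ * A * R⁻¹).IsHermitian := isHermitian_conjTranspose_mul_mul R⁻¹ hA
  set U : Matrix n n 𝕜 := (hH.eigenvectorUnitary : Matrix n n 𝕜)
  have hU : Uᴴ * U = 1 := Unitary.coe_star_mul_self hH.eigenvectorUnitary
  refine ⟨R⁻¹ * U, hH.eigenvalues, ?_, ?_⟩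
  · calc (R⁻¹ * U)ᴴ * (Rᴴ * R) * (R⁻¹ * U) = Uᴴ * ((R * R⁻¹)ᴴ * (R * R⁻¹)) * U := by
          simp only [conjTranspose_mul, Matrix.mul_assoc]
      _ = 1 := by rw [hRinv, conjTranspose_one, Matrix.mul_one, Matrix.mul_one, hU]
  · rw [← hH.conjStarAlgAut_star_eigenvectorUnitary, Unitary.conjStarAlgAut_star_apply]
    simp only [conjTranspose_mul, Matrix.mul_assoc, star_eq_conjTranspose, U]

theorem genEigList_eq_sort [DecidableEq n] {A B R S : Matrix n n ℝ} {D : n → ℝ}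
    (hB : R * B * S = 1) (hA : R * A * S = diagonal D) :
    genEigList A B = (Finset.univ.val.map D).sort (· ≤ ·) := by
  have pencil : R.map C * (A.map C - (X : ℝ[X]) • B.map C) * S.map C =
      diagonal fun i => C (D i) - X := by
    have hA' := congrArg (·.map (C : ℝ →+* ℝ[X])) hA
    have hB' := congrArg (·.map (C : ℝ →+* ℝ[X])) hB
    simp only [Matrix.map_mul] at hA' hB'
    rw [Matrix.mul_sub, Matrix.sub_mul, Matrix.mul_smul, Matrix.smul_mul, hA', hB']
    ext i j
    by_cases hij : i = j <;> simp [hij]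
  have det_ne_zero : R.det * S.det ≠ 0 := by
    have := congrArg det hB
    rw [det_mul, det_mul, det_one] at this
    exact left_ne_zero_of_mul_eq_one ((mul_right_comm _ _ _).trans this)
  have det_pencil : C (R.det * S.det) * (A.map C - (X : ℝ[X]) • B.map C).det =
      ∏ i, (C (D i) - X) := by
    have := congrArg det pencil
    rw [det_mul, det_mul, det_diagonal, mul_right_comm] at this
    rw [← this, C_mul, RingHom.map_det, RingHom.map_det]
    rfl
  have roots_pencil : (A.map C - (X : ℝ[X]) • B.map C).det.roots = Finset.univ.val.map D := by
    rw [← roots_C_mul _ det_ne_zero, det_pencil, roots_prod]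
    · simp only [← neg_sub X, roots_neg, roots_X_sub_C, Multiset.bind_singleton]
    · refine Finset.prod_ne_zero_iff.2 fun i _ => ?_
      rw [← neg_sub X]
      exact neg_ne_zero.2 (X_sub_C_ne_zero _)
  rw [genEigList, ← roots_pencil]
  congr!

theorem length_genEigList {A B : Matrix n n ℝ} (hA : A.IsHermitian) (hB : B.PosDef) :
    (genEigList A B).length = Fintype.card n := by
  classical
  obtain ⟨S, D, hSB, hSA⟩ := exists_conjTranspose_mul_mul_eq_one_eq_diagonal hA hB
  simp [genEigList_eq_sort hSB hSA]

theorem genEig_mem_genEigList {A B : Matrix n n ℝ} (hA : A.IsHermitian) (hB : B.PosDef) {k : ℕ}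
    (hk : k < Fintype.card n) : genEig A B k ∈ genEigList A B := by
  rw [← length_genEigList hA hB] at hk
  rw [genEig, List.getD_eq_getElem _ _ hk]
  exact List.getElem_mem hk

theorem genEig_nonneg {A B : Matrix n n ℝ} (hA : A.PosSemidef) (hB : B.PosDef) {k : ℕ}
    (hk : k < Fintype.card n) : 0 ≤ genEig A B k := by
  classical
  obtain ⟨S, D, hSB, hSA⟩ := exists_conjTranspose_mul_mul_eq_one_eq_diagonal hA.isHermitian hB
  have hD : ∀ i, 0 ≤ D i := posSemidef_diagonal_iff.1 (hSA ▸ hA.conjTranspose_mul_mul_same S)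
  have hmem := genEig_mem_genEigList hA.isHermitian hB hk
  rw [genEigList_eq_sort hSB hSA, Multiset.mem_sort, Multiset.mem_map] at hmem
  obtain ⟨i, -, hi⟩ := hmem
  exact hi ▸ hD i

theorem dotProduct_mulVec_of_congruence [DecidableEq n] {A S : Matrix n n ℝ} {D : n → ℝ}
    (h : Sᴴ * A * S = diagonal D) (y : n → ℝ) :
    (S *ᵥ y) ⬝ᵥ A *ᵥ (S *ᵥ y) = ∑ i, D i * y i ^ 2 := by
  calc (S *ᵥ y) ⬝ᵥ A *ᵥ (S *ᵥ y) = y ⬝ᵥ (Sᴴ * A * S) *ᵥ y := by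
        rw [← mulVec_mulVec, ← mulVec_mulVec, dotProduct_mulVec y,
          conjTranspose_eq_transpose_of_trivial, vecMul_transpose]
    _ = ∑ i, D i * y i ^ 2 := by
        simp only [h, dotProduct, mulVec_diagonal]
        exact Finset.sum_congr rfl fun i _ => by ring

theorem dotProduct_mulVec_sub_of_congruence [DecidableEq n] {A B S : Matrix n n ℝ} {D : n → ℝ}
    (hB : Sᴴ * B * S = 1) (hA : Sᴴ * A * S = diagonal D) (t : ℝ) (y : n → ℝ) :
    (S *ᵥ y) ⬝ᵥ A *ᵥ (S *ᵥ y) - t * ((S *ᵥ y) ⬝ᵥ B *ᵥ (S *ᵥ y)) = ∑ i, (D i - t) * y i ^ 2 := by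
  rw [dotProduct_mulVec_of_congruence hA,
    dotProduct_mulVec_of_congruence (hB.trans diagonal_one.symm), Finset.mul_sum,
    ← Finset.sum_sub_distrib]
  exact Finset.sum_congr rfl fun i _ => by ring

theorem eq_zero_of_sum_sub_mul_sq_nonpos {D y : n → ℝ} {t : ℝ} (hy : ∀ i, D i ≤ t → y i = 0)
    (hsum : ∑ i, (D i - t) * y i ^ 2 ≤ 0) : y = 0 := by
  have term_nonneg (i) : 0 ≤ (D i - t) * y i ^ 2 := by
    by_cases hi : D i ≤ t
    · simp [hy i hi]
    · exact mul_nonneg (by linarith) (sq_nonneg _)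
  have term_eq_zero := (Fintype.sum_eq_zero_iff_of_nonneg term_nonneg).1
    (hsum.antisymm (Finset.sum_nonneg fun i _ => term_nonneg i))
  ext i
  by_cases hi : D i ≤ t
  · exact hy i hi
  · simpa [sub_eq_zero, (not_le.1 hi).ne'] using congrFun term_eq_zero i

theorem finrank_le_card_of_forall_quadratic_le [DecidableEq n] {A B S : Matrix n n ℝ} {D : n → ℝ}
    (hB : Sᴴ * B * S = 1) (hA : Sᴴ * A * S = diagonal D) {t : ℝ} {W : Submodule ℝ (n → ℝ)}
    (hW : ∀ x ∈ W, x ⬝ᵥ A *ᵥ x ≤ t * (x ⬝ᵥ B *ᵥ x)) :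
    Module.finrank ℝ W ≤ Fintype.card {i // D i ≤ t} := by
  let lowCoords : W →ₗ[ℝ] {i // D i ≤ t} → ℝ :=
    LinearMap.funLeft ℝ ℝ Subtype.val ∘ₗ (Sᴴ * B).mulVecLin ∘ₗ W.subtype
  rw [← Module.finrank_fintype_fun_eq_card ℝ]
  refine LinearMap.finrank_le_finrank_of_injective (f := lowCoords)
    ((injective_iff_map_eq_zero _).2 fun x hx => ?_)
  have hxS : S *ᵥ ((Sᴴ * B) *ᵥ x) = (x : n → ℝ) := by
    rw [mulVec_mulVec, mul_eq_one_comm.1 hB, one_mulVec]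
  have coords_eq_zero : (Sᴴ * B) *ᵥ (x : n → ℝ) = 0 :=
    eq_zero_of_sum_sub_mul_sq_nonpos (fun i hi => congrFun hx ⟨i, hi⟩) (by
      rw [← dotProduct_mulVec_sub_of_congruence hB hA, hxS, sub_nonpos]
      exact hW x x.2)
  rw [coords_eq_zero, mulVec_zero] at hxS
  exact Subtype.ext hxS.symm

theorem exists_finrank_eq_card_forall_quadratic_le [DecidableEq n] {A B S : Matrix n n ℝ}
    {D : n → ℝ} (hB : Sᴴ * B * S = 1) (hA : Sᴴ * A * S = diagonal D) (t : ℝ) :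
    ∃ W : Submodule ℝ (n → ℝ), Module.finrank ℝ W = Fintype.card {i // D i ≤ t} ∧
      ∀ x ∈ W, x ⬝ᵥ A *ᵥ x ≤ t * (x ⬝ᵥ B *ᵥ x) := by
  let extend : ({i // D i ≤ t} → ℝ) →ₗ[ℝ] n → ℝ := Function.ExtendByZero.linearMap ℝ Subtype.val
  have mulVec_injective : Function.Injective S.mulVecLin :=
    mulVec_injective_of_isUnit (.of_mul_eq_one_right _ hB)
  refine ⟨LinearMap.range (S.mulVecLin ∘ₗ extend), ?_, ?_⟩
  · rw [LinearMap.finrank_range_of_inj, Module.finrank_fintype_fun_eq_card]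
    exact mulVec_injective.comp (Function.extend_injective Subtype.val_injective (0 : n → ℝ))
  · rintro _ ⟨y, rfl⟩
    rw [← sub_nonpos]
    refine (dotProduct_mulVec_sub_of_congruence hB hA t (extend y)).trans_le
      (Finset.sum_nonpos fun i _ => ?_)
    by_cases hi : D i ≤ t
    · exact mul_nonpos_of_nonpos_of_nonneg (by linarith) (sq_nonneg _)
    · have : extend y i = 0 := Function.extend_apply' _ _ _ fun ⟨j, hj⟩ => hi (hj ▸ j.2)
      simp [this]

theorem genEig_le_iff_lt_card [DecidableEq n] {A B S : Matrix n n ℝ} {D : n → ℝ}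
    (hB : Sᴴ * B * S = 1) (hA : Sᴴ * A * S = diagonal D) {k : ℕ} (hk : k < Fintype.card n)
    {t : ℝ} : genEig A B k ≤ t ↔ k < Fintype.card {i // D i ≤ t} := by
  have hk' : k < ((Finset.univ.val.map D).sort (· ≤ ·)).length := by simpa using hk
  rw [genEig, genEigList_eq_sort hB hA, List.getD_eq_getElem _ _ hk',
    getElem_le_iff_lt_countP (Multiset.pairwise_sort _ _), ← Multiset.coe_countP,
    Multiset.sort_eq, Multiset.countP_map, Fintype.card_subtype]
  rfl

-- The Courant-Fischer min-max principle, stated without Rayleigh quotients.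
theorem genEig_le_iff_exists_submodule {A B : Matrix n n ℝ} (hA : A.IsHermitian) (hB : B.PosDef)
    {k : ℕ} (hk : k < Fintype.card n) {t : ℝ} :
    genEig A B k ≤ t ↔ ∃ W : Submodule ℝ (n → ℝ), k < Module.finrank ℝ W ∧
      ∀ x ∈ W, x ⬝ᵥ A *ᵥ x ≤ t * (x ⬝ᵥ B *ᵥ x) := by
  classical
  obtain ⟨S, D, hSB, hSA⟩ := exists_conjTranspose_mul_mul_eq_one_eq_diagonal hA hB
  rw [genEig_le_iff_lt_card hSB hSA hk]
  constructor
  · intro hlt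
    obtain ⟨W, hcard, hW⟩ := exists_finrank_eq_card_forall_quadratic_le hSB hSA t
    exact ⟨W, hcard ▸ hlt, hW⟩
  · rintro ⟨W, hlt, hW⟩
    exact hlt.trans_le (finrank_le_card_of_forall_quadratic_le hSB hSA hW)

theorem genEig_antitone {A B B' : Matrix n n ℝ} (hA : A.PosSemidef) (hB : B.PosDef)
    (hB' : B'.PosDef) (hBB' : (B' - B).PosSemidef) {k : ℕ} (hk : k < Fintype.card n) :
    genEig A B' k ≤ genEig A B k := by
  obtain ⟨W, hrank, hW⟩ := (genEig_le_iff_exists_submodule hA.isHermitian hB hk).1 le_rfl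
  refine (genEig_le_iff_exists_submodule hA.isHermitian hB' hk).2 ⟨W, hrank, fun x hx => ?_⟩
  have quadratic_le : x ⬝ᵥ B *ᵥ x ≤ x ⬝ᵥ B' *ᵥ x := by
    simpa [sub_mulVec, dotProduct_sub] using hBB'.dotProduct_mulVec_nonneg x
  exact (hW x hx).trans (mul_le_mul_of_nonneg_left quadratic_le (genEig_nonneg hA hB hk))

theorem criticalTimeStep_mono {A B B' : Matrix n n ℝ} (hA : A.PosSemidef) (hB : B.PosDef)
    (hB' : B'.PosDef) (hBB' : (B' - B).PosSemidef) :
    criticalTimeStep A B ≤ criticalTimeStep A B' := by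
  refine ENNReal.div_le_div_left (ENNReal.ofReal_le_ofReal (Real.sqrt_le_sqrt ?_)) _
  rcases isEmpty_or_nonempty n with hn | hn
  · have genEigList_eq_nil {C : Matrix n n ℝ} (hC : C.PosDef) : genEigList A C = [] :=
      List.length_eq_zero_iff.1 ((length_genEigList hA.isHermitian hC).trans Fintype.card_eq_zero)
    simp [genEig, genEigList_eq_nil hB, genEigList_eq_nil hB']
  · exact genEig_antitone hA hB hB' hBB' (Nat.sub_lt Fintype.card_pos one_pos)

end Pencil

end SpectralFEM

end

theorem lemma3p1 {d : ℕ} {q : Fin d → ℕ} (hq : ∀ j, 1 ≤ q j)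
    {E : Type*} [Fintype E] (T : SpectralFEM.Mesh d q E)
    (Γ : Set (EuclideanSpace ℝ (Fin d)))
    (κ : EuclideanSpace ℝ (Fin d) → ℝ) (hκ : ∀ x ∈ T.domain, 0 < κ x)
    (hκint : MeasureTheory.IntegrableOn κ T.domain)
    (ρ : EuclideanSpace ℝ (Fin d) → ℝ) (ρe : E → ℝ)
    (hρ : ∀ e, ∀ x ∈ interior (T.element e), ρ x = ρe e) (hρpos : ∀ e, 0 < ρe e) :
    (T.massMatrix Γ ρ).PosDef ∧ (T.lumpedMatrix Γ ρe).PosDef ∧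
    (T.lumpedMatrix Γ ρe - T.massMatrix Γ ρ).PosSemidef ∧
    (SpectralFEM.genEigList (T.stiffMatrix Γ κ) (T.massMatrix Γ ρ)).length
      = (T.freeNodes Γ).card ∧
    (SpectralFEM.genEigList (T.stiffMatrix Γ κ) (T.lumpedMatrix Γ ρe)).length
      = (T.freeNodes Γ).card ∧
    (∀ k < (T.freeNodes Γ).card,
      SpectralFEM.genEig (T.stiffMatrix Γ κ) (T.lumpedMatrix Γ ρe) k
        ≤ SpectralFEM.genEig (T.stiffMatrix Γ κ) (T.massMatrix Γ ρ) k) ∧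
    SpectralFEM.criticalTimeStep (T.stiffMatrix Γ κ) (T.massMatrix Γ ρ)
      ≤ SpectralFEM.criticalTimeStep (T.stiffMatrix Γ κ) (T.lumpedMatrix Γ ρe) := by
  have hM := T.massMatrix_posDef Γ hq hρ hρpos
  have hsub := T.lumpedMatrix_sub_massMatrix_posSemidef Γ hq hρ fun e => (hρpos e).le
  have hL : (T.lumpedMatrix Γ ρe).PosDef := by
    simpa only [add_sub_cancel] using hM.add_posSemidef hsub
  have hK := T.stiffMatrix_posSemidef Γ (fun x hx => (hκ x hx).le) hκint
  have hcard : Fintype.card (T.freeNodes Γ) = (T.freeNodes Γ).card := Fintype.card_coe _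
  refine ⟨hM, hL, hsub, ?_, ?_, fun k hk => ?_, ?_⟩
  · rw [SpectralFEM.length_genEigList hK.isHermitian hM, hcard]
  · rw [SpectralFEM.length_genEigList hK.isHermitian hL, hcard]
  · exact SpectralFEM.genEig_antitone hK hM hL hsub (hcard ▸ hk)
  · exact SpectralFEM.criticalTimeStep_mono hK hM hL hsub
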